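/- For real $\nu$ and $x>0$ let $I_\nu(x)=\left(\frac x2\right)^{\nu}\sum_{k\ge0}\frac{(x^2/4)^k}{k!\,\Gamma(\nu+k+1)}$ be the modified Bessel function of the first kind (with $1/\Gamma=0$ at the poles of $\Gamma$). For real $\alpha,\nu$ and $x>0$ put $$B_\alpha(\nu,x)=\frac{x}{\delta_\alpha(\nu,x)+\sqrt{\delta_\alpha(\nu,x)^2+x^2}},\qquad \delta_\alpha(\nu,x)=\nu-\tfrac12+\frac{\lambda}{2\sqrt{\lambda^2+x^2}},\qquad \lambda=\nu+\frac{\alpha-1}{2}.$$ Then, for all $x>0$, $$\frac{I_\nu(x)}{I_{\nu-1}(x)}<B_0(\nu,x)\quad(\nu\ge\tfrac12),\qquad \frac{I_\nu(x)}{I_{\nu-1}(x)}>B_2(\nu,x)\quad(\nu\ge0).$$ These bounds are the best possible of the form $B_\alpha(\nu,x)$ with fixed $\alpha\in\mathbb R$ (that is, $\alpha$ independent of $\nu$ and $x$), in the following sense: 1. if $\alpha\in\mathbb R$ is such that $I_\nu(x)/I_{\nu-1}(x)\le B_\alpha(\nu,x)$ for all $\nu\ge\frac12$ and $x>0$, then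 $B_0(\nu,x)\le B_\alpha(\nu,x)$ for all $\nu\ge\frac12$ and $x>0$; 2. if $\alpha\in\mathbb R$ is such that $I_\nu(x)/I_{\nu-1}(x)\ge B_\alpha(\nu,x)$ for all $\nu\ge0$ and $x>0$, then $B_\alpha(\nu,x)\le B_2(\nu,x)$ for all $\nu\ge0$ and $x>0$. Moreover, for all real $\nu$ and all $x>0$ the function $\alpha\mapsto B_\alpha(\nu,x)$ is strictly decreasing on $\mathbb R$; and for every $\alpha\in(0,2)$ there is an $N$ such that for every $\nu\ge N$ neither $I_\nu(x)/I_{\nu-1}(x)\le B_\alpha(\nu,x)$ for all $x>0$, nor $I_\nu(x)/I_{\nu-1}(x)\ge B_\alpha(\nu,x)$ for all $x>0$. -/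

import Mathlib

/-- The modified Bessel function of the first kind `I_ν(x)` of real order `ν`, for `0 < x`,
through its standard power series
`I_ν(x) = (x/2)^ν ∑ₖ (x²/4)^k / (k! Γ(ν + k + 1))`.
At the poles of `Γ` Mathlib has `Real.Gamma = 0`, so that the corresponding terms vanish,
which is the usual convention `1/Γ(-m) = 0`. -/
noncomputable def besselI (ν x : ℝ) : ℝ :=
  (x / 2) ^ ν * ∑' k : ℕ, (x ^ 2 / 4) ^ k / ((Nat.factorial k : ℝ) * Real.Gamma (ν + k + 1))

/-- `λ = ν + (α - 1)/2`. -/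
noncomputable def lam (α ν : ℝ) : ℝ := ν + (α - 1) / 2

/-- `δ_α(ν, x) = (ν - 1/2) + λ / (2 √(λ² + x²))` with `λ = ν + (α - 1)/2`. -/
noncomputable def delta (α ν x : ℝ) : ℝ :=
  (ν - 1 / 2) + lam α ν / (2 * Real.sqrt ((lam α ν) ^ 2 + x ^ 2))

/-- `B_α(ν, x) = x / (δ_α(ν, x) + √(δ_α(ν, x)² + x²))`. -/
noncomputable def boundB (α ν x : ℝ) : ℝ :=
  x / (delta α ν x + Real.sqrt ((delta α ν x) ^ 2 + x ^ 2))

/-! The ratio R = I_ν/I_{ν-1} solves the Riccati equation R' = 1 - (2ν-1)R/x - R². Since B_α is the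
positive root of y² + (2δ_α/x)y - 1 = 0, it solves the same equation up to an error (B_α/x)·D_α,
with D_α the function `boundDefect`. Squaring out the square root shows D_0 > 0 for ν > 1/2 and D_2
< 0 for ν ≥ 0. So B_0 is a strict supersolution and B_2 a strict subsolution, and comparison
(`pos_of_deriv_pos_of_nonpos`) gives the bounds. It does not reach two endpoints: at ν = 1/2, B_0 =
1 is an exact solution, and ν = 0 is reduced to the upper bound at ν = 1.

Optimality comes from the two ends of (0, ∞). As x → 0, expanding to order x² gives R < B_α
somewhere once λ² < ν(ν+1), which for α < 2 holds for all large ν. As x → ∞, x·D_α → -α/2, so for α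
> 0 and ν ≥ 1/2, B_α cannot stay above R. Hence an upper bound forces α ≤ 0 and a lower bound forces
α ≥ 2; monotonicity in α finishes. -/

open Filter Topology Set

/-! ### Power series: convergence, derivative, recurrence -/

/-- The entire function `∑ₖ t^k / (k! Γ(μ + k + 1))`, so that
`I_μ(x) = (x/2)^μ * besselSeries μ (x²/4)`. -/
noncomputable def besselSeries (μ t : ℝ) : ℝ :=
  ∑' k : ℕ, t ^ k / ((Nat.factorial k : ℝ) * Real.Gamma (μ + k + 1))

theorem exists_pos_le_Gamma_add_nat {μ : ℝ} (hμ : -1 < μ) :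
    ∃ m : ℝ, 0 < m ∧ ∀ k : ℕ, m ≤ Real.Gamma (μ + k + 1) := by
  have h1 : 0 < Real.Gamma (μ + 1) := Real.Gamma_pos_of_pos (by linarith)
  have h2 : 0 < Real.Gamma (μ + 2) := Real.Gamma_pos_of_pos (by linarith)
  -- The first factor μ + 1 may be less than 1, but all later ones exceed 1, so the first two values
  -- suffice.
  refine ⟨min (Real.Gamma (μ + 1)) (Real.Gamma (μ + 2)), lt_min h1 h2, fun k => ?_⟩
  rcases k with _ | k
  · simp
  refine (min_le_right _ _).trans ?_
  induction k with
  | zero => norm_num [add_assoc]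
  | succ k ih =>
    have hk : (0 : ℝ) ≤ k := k.cast_nonneg
    have e : Real.Gamma (μ + ((k + 1 + 1 : ℕ) : ℝ) + 1)
        = (μ + k + 2) * Real.Gamma (μ + ((k + 1 : ℕ) : ℝ) + 1) := by
      rw [show μ + k + 2 = μ + ((k + 1 : ℕ) : ℝ) + 1 by push_cast; ring,
        ← Real.Gamma_add_one (by push_cast; linarith)]
      congr 1; push_cast; ring
    rw [e]
    nlinarith [h2.trans_le ih]

theorem Gamma_add_nat_pos {μ : ℝ} (hμ : -1 < μ) (k : ℕ) : 0 < Real.Gamma (μ + k + 1) :=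
  Real.Gamma_pos_of_pos (by have : (0 : ℝ) ≤ k := k.cast_nonneg
                            linarith)

theorem summable_besselSeries {μ : ℝ} (hμ : -1 < μ) (t : ℝ) :
    Summable fun k : ℕ => t ^ k / ((Nat.factorial k : ℝ) * Real.Gamma (μ + k + 1)) := by
  obtain ⟨m, hm, hle⟩ := exists_pos_le_Gamma_add_nat hμ
  refine Summable.of_norm_bounded ((Real.summable_pow_div_factorial |t|).mul_left m⁻¹) fun k => ?_
  have hf : (0 : ℝ) < Nat.factorial k := by exact_mod_cast k.factorial_pos
  have hG := Gamma_add_nat_pos hμ k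
  rw [norm_div, norm_pow, Real.norm_eq_abs, Real.norm_of_nonneg (by positivity),
    inv_mul_eq_div, div_div]
  gcongr
  exact hle k

theorem besselSeries_term_deriv (μ t : ℝ) (k : ℕ) :
    (((k + 1 : ℕ) : ℝ) * t ^ k) / ((Nat.factorial (k + 1) : ℝ) *
      Real.Gamma (μ + ((k + 1 : ℕ) : ℝ) + 1))
      = t ^ k / ((Nat.factorial k : ℝ) * Real.Gamma (μ + 1 + k + 1)) := by
  have hf : (Nat.factorial k : ℝ) ≠ 0 := by exact_mod_cast k.factorial_ne_zero
  have hk : ((k : ℝ) + 1) ≠ 0 := by positivity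
  rw [Nat.factorial_succ, show μ + ((k + 1 : ℕ) : ℝ) + 1 = μ + 1 + k + 1 by push_cast; ring]
  push_cast
  rw [mul_assoc, mul_div_mul_left _ _ hk]

theorem hasDerivAt_besselSeries {μ : ℝ} (hμ : -1 < μ) (t : ℝ) :
    HasDerivAt (besselSeries μ) (besselSeries (μ + 1) t) t := by
  have hμ' : -1 < μ + 1 := by linarith
  set g : ℕ → ℝ → ℝ := fun k y => y ^ k / ((Nat.factorial k : ℝ) * Real.Gamma (μ + k + 1)) with hg
  set g' : ℕ → ℝ → ℝ := fun k y =>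
    ((k : ℝ) * y ^ (k - 1)) / ((Nat.factorial k : ℝ) * Real.Gamma (μ + k + 1)) with hg'
  have hsucc : ∀ y k, g' (k + 1) y
      = y ^ k / ((Nat.factorial k : ℝ) * Real.Gamma (μ + 1 + k + 1)) := fun y k =>
    besselSeries_term_deriv μ y k
  have hsum : ∀ y, Summable fun k => g' k y := fun y => by
    rw [← summable_nat_add_iff 1]
    simpa only [hsucc] using summable_besselSeries hμ' y
  -- On the ball of radius |t| + 1 the differentiated terms are dominated by their values at |t| +
  -- 1, all coefficients being nonnegative.
  have key := hasDerivAt_tsum_of_isPreconnected (g := g) (g' := g') (u := fun k => g' k (|t| + 1))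
    (t := Metric.ball 0 (|t| + 1)) (y₀ := t) (y := t) (hsum _) Metric.isOpen_ball
    (convex_ball _ _).isPreconnected
    (fun k y _ => (hasDerivAt_pow k y).div_const _)
    (fun k y hy => by
      have hy' : |y| ≤ |t| + 1 := by simpa using (mem_ball_zero_iff.1 hy).le
      have hf : (0 : ℝ) < Nat.factorial k := by exact_mod_cast k.factorial_pos
      have hG := Gamma_add_nat_pos hμ k
      simp only [hg']
      rw [norm_div, norm_mul, norm_pow, Real.norm_eq_abs y, Real.norm_of_nonneg (by positivity),
        Real.norm_of_nonneg (by positivity)]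
      gcongr)
    (by simp) (summable_besselSeries hμ t) (by simp)
  have e : ∑' k, g' k t = besselSeries (μ + 1) t := by
    rw [(hsum t).tsum_eq_zero_add]
    simp only [hsucc]
    simp [hg', besselSeries]
  rw [e] at key
  exact key

theorem besselSeries_pos {μ t : ℝ} (hμ : -1 < μ) (ht : 0 ≤ t) : 0 < besselSeries μ t := by
  refine (summable_besselSeries hμ t).tsum_pos (fun k => ?_) 0 ?_
  · have := Gamma_add_nat_pos hμ k
    positivity
  · have := Gamma_add_nat_pos hμ 0
    simpa using this

theorem besselSeries_zero (μ : ℝ) : besselSeries μ 0 = (Real.Gamma (μ + 1))⁻¹ := by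
  rw [besselSeries, tsum_eq_single 0 (fun k hk => by simp [hk])]
  simp

/-- Termwise 1/Γ(ν+k) = (ν+k)/Γ(ν+k+1); the factor k cancels into k! and shifts the index. -/
theorem besselSeries_sub_one {ν : ℝ} (hν : 0 < ν) (t : ℝ) :
    besselSeries (ν - 1) t = ν * besselSeries ν t + t * besselSeries (ν + 1) t := by
  have h1 := summable_besselSeries (show -1 < ν by linarith) t
  have h2 := summable_besselSeries (show -1 < ν + 1 by linarith) t
  set b : ℕ → ℝ := fun k =>
    (k : ℝ) * (t ^ k / ((Nat.factorial k : ℝ) * Real.Gamma (ν + k + 1))) with hb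
  have hbs : ∀ k, b (k + 1)
      = t * (t ^ k / ((Nat.factorial k : ℝ) * Real.Gamma (ν + 1 + k + 1))) := fun k => by
    rw [← besselSeries_term_deriv, hb]
    ring
  have hbsum : Summable b := by
    rw [← summable_nat_add_iff 1]
    simpa only [hbs] using h2.mul_left t
  have e : t * besselSeries (ν + 1) t = ∑' k, b k := by
    rw [hbsum.tsum_eq_zero_add, besselSeries, ← tsum_mul_left]
    simp only [hbs]
    simp [hb]
  rw [e, besselSeries, besselSeries, ← tsum_mul_left, ← (h1.mul_left ν).tsum_add hbsum]
  refine tsum_congr fun k => ?_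
  have hk : (0 : ℝ) ≤ k := k.cast_nonneg
  have hG : Real.Gamma (ν + k) ≠ 0 := (Real.Gamma_pos_of_pos (by linarith)).ne'
  have hf : (Nat.factorial k : ℝ) ≠ 0 := by exact_mod_cast k.factorial_ne_zero
  have hne : ν + k ≠ 0 := by linarith
  simp only [hb]
  rw [show ν - 1 + k + 1 = ν + k by ring, Real.Gamma_add_one hne]
  field_simp

theorem mul_besselSeries_le {ν t : ℝ} (hν : 0 < ν) (ht : 0 ≤ t) :
    ν * besselSeries ν t ≤ besselSeries (ν - 1) t := by
  rw [besselSeries_sub_one hν]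
  have := besselSeries_pos (show -1 < ν + 1 by linarith) ht
  nlinarith [mul_nonneg ht this.le]

/-- Serves ν = 0, where I_{-1} lies outside the range μ > -1. The k = 0 term vanishes because
`Real.Gamma 0 = 0` and division by zero gives zero. -/
theorem besselSeries_neg_one (t : ℝ) : besselSeries (-1) t = t * besselSeries 1 t := by
  have h1 := summable_besselSeries (show (-1 : ℝ) < 1 by norm_num) t
  have hbs : ∀ k : ℕ, t ^ (k + 1) /
        ((Nat.factorial (k + 1) : ℝ) * Real.Gamma (-1 + ((k + 1 : ℕ) : ℝ) + 1))
      = t * (t ^ k / ((Nat.factorial k : ℝ) * Real.Gamma (1 + k + 1))) := fun k => by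
    have hf : (Nat.factorial k : ℝ) ≠ 0 := by exact_mod_cast k.factorial_ne_zero
    have hG : Real.Gamma ((k : ℝ) + 1) ≠ 0 := (Real.Gamma_pos_of_pos (by positivity)).ne'
    have hk : ((k : ℝ) + 1) ≠ 0 := by positivity
    rw [show (-1 : ℝ) + ((k + 1 : ℕ) : ℝ) + 1 = k + 1 by push_cast; ring,
      show (1 : ℝ) + k + 1 = (k + 1) + 1 by ring, Real.Gamma_add_one hk, Nat.factorial_succ]
    push_cast
    field_simp
    ring
  rw [besselSeries, Summable.tsum_eq_zero_add, besselSeries, ← tsum_mul_left]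
  · simp only [hbs]
    simp
  · rw [← summable_nat_add_iff 1]
    simpa only [hbs] using h1.mul_left t

/-! ### The ratio and its Riccati equation -/

theorem besselI_eq (ν x : ℝ) : besselI ν x = (x / 2) ^ ν * besselSeries ν (x ^ 2 / 4) := rfl

theorem besselI_pos {ν x : ℝ} (hν : -1 < ν) (hx : 0 < x) : 0 < besselI ν x :=
  mul_pos (Real.rpow_pos_of_pos (by positivity) _) (besselSeries_pos hν (by positivity))

theorem besselI_neg_one {x : ℝ} (hx : 0 < x) : besselI (-1) x = besselI 1 x := by
  rw [besselI_eq, besselI_eq, besselSeries_neg_one, Real.rpow_neg_one, Real.rpow_one]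
  field_simp
  ring

/-- The ratio `I_ν(x) / I_{ν-1}(x)`. -/
noncomputable def besselRatio (ν x : ℝ) : ℝ := besselI ν x / besselI (ν - 1) x

theorem besselRatio_eq {ν x : ℝ} (hx : 0 < x) :
    besselRatio ν x = x / 2 * (besselSeries ν (x ^ 2 / 4) / besselSeries (ν - 1) (x ^ 2 / 4)) := by
  have h : (0 : ℝ) < x / 2 := by positivity
  have hp : (x / 2) ^ (ν - 1) ≠ 0 := (Real.rpow_pos_of_pos h _).ne'
  have e : (x / 2) ^ ν = (x / 2) ^ (ν - 1) * (x / 2) := by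
    rw [← Real.rpow_add_one h.ne', sub_add_cancel]
  rw [besselRatio, besselI_eq, besselI_eq, e, mul_assoc, mul_div_mul_left _ _ hp, mul_div_assoc]

theorem besselRatio_pos {ν x : ℝ} (hν : 0 < ν) (hx : 0 < x) : 0 < besselRatio ν x :=
  div_pos (besselI_pos (by linarith) hx) (besselI_pos (by linarith) hx)

theorem besselRatio_le {ν x : ℝ} (hν : 0 < ν) (hx : 0 < x) : besselRatio ν x ≤ x / (2 * ν) := by
  have h0 := besselSeries_pos (show -1 < ν - 1 by linarith) (show 0 ≤ x ^ 2 / 4 by positivity)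
  have h1 := mul_besselSeries_le hν (show 0 ≤ x ^ 2 / 4 by positivity)
  rw [besselRatio_eq hx, show x / (2 * ν) = x / 2 * (1 / ν) by field_simp]
  gcongr ?_ * ?_
  rw [div_le_div_iff₀ h0 hν]
  linarith

/-- Isolates the x² coefficient needed for the expansion at 0. -/
theorem div_besselRatio {ν x : ℝ} (hν : 0 < ν) (hx : 0 < x) :
    x / besselRatio ν x = 2 * ν
      + x ^ 2 * (besselSeries (ν + 1) (x ^ 2 / 4) / (2 * besselSeries ν (x ^ 2 / 4))) := by
  have h0 := besselSeries_pos (show -1 < ν by linarith) (show 0 ≤ x ^ 2 / 4 by positivity)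
  have h1 := besselSeries_pos (show -1 < ν - 1 by linarith) (show 0 ≤ x ^ 2 / 4 by positivity)
  have h2 := besselSeries_sub_one hν (x ^ 2 / 4)
  rw [besselRatio_eq hx]
  field_simp
  rw [h2]
  ring

/-- The Riccati equation of the ratio. -/
theorem hasDerivAt_besselRatio {ν x : ℝ} (hν : 0 < ν) (hx : 0 < x) :
    HasDerivAt (besselRatio ν)
      (1 - (2 * ν - 1) / x * besselRatio ν x - besselRatio ν x ^ 2) x := by
  have h1 := besselSeries_pos (show -1 < ν - 1 by linarith) (show 0 ≤ x ^ 2 / 4 by positivity)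
  have h2 := besselSeries_sub_one hν (x ^ 2 / 4)
  have hd : HasDerivAt (fun y : ℝ => y ^ 2 / 4) (x / 2) x := by
    refine ((hasDerivAt_pow 2 x).div_const 4).congr_deriv ?_
    push_cast
    ring
  have d1 := (hasDerivAt_besselSeries (show -1 < ν by linarith) (x ^ 2 / 4)).comp x hd
  have d2 := (hasDerivAt_besselSeries (show -1 < ν - 1 by linarith) (x ^ 2 / 4)).comp x hd
  rw [sub_add_cancel] at d2
  have d3 := ((hasDerivAt_id x).div_const 2).mul (d1.div d2 h1.ne')
  have heq : besselRatio ν =ᶠ[𝓝 x] fun y =>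
      y / 2 * (besselSeries ν (y ^ 2 / 4) / besselSeries (ν - 1) (y ^ 2 / 4)) := by
    filter_upwards [lt_mem_nhds hx] with y hy using besselRatio_eq hy
  refine HasDerivAt.congr_of_eventuallyEq ?_ heq
  refine HasDerivAt.congr_deriv d3 ?_
  rw [besselRatio_eq hx]
  simp only [Function.comp, id, Pi.div_apply]
  have h3 : besselSeries (ν + 1) (x ^ 2 / 4)
      = (besselSeries (ν - 1) (x ^ 2 / 4) - ν * besselSeries ν (x ^ 2 / 4)) / (x ^ 2 / 4) := by
    rw [h2]; field_simp; simp
  rw [h3]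
  field_simp
  ring

/-! ### The bound as an approximate Riccati solution -/

theorem delta_eq (α ν x : ℝ) :
    delta α ν x = (ν - 1 / 2) + (lam α ν / √(lam α ν ^ 2 + x ^ 2)) / 2 := by
  rw [delta, div_div, mul_comm]

theorem add_sqrt_sq_add_sq_pos (d : ℝ) {x : ℝ} (hx : 0 < x) : 0 < d + √(d ^ 2 + x ^ 2) := by
  have : |d| < √(d ^ 2 + x ^ 2) := Real.lt_sqrt_of_sq_lt (by rw [sq_abs]; nlinarith)
  linarith [neg_abs_le d]

theorem boundB_pos (α ν : ℝ) {x : ℝ} (hx : 0 < x) : 0 < boundB α ν x :=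
  div_pos hx (add_sqrt_sq_add_sq_pos _ hx)

theorem boundB_eq (α ν : ℝ) {x : ℝ} (hx : 0 < x) :
    boundB α ν x = (√(delta α ν x ^ 2 + x ^ 2) - delta α ν x) / x := by
  have h := add_sqrt_sq_add_sq_pos (delta α ν x) hx
  have hs := Real.sq_sqrt (show 0 ≤ delta α ν x ^ 2 + x ^ 2 by positivity)
  rw [boundB, div_eq_div_iff h.ne' hx.ne']
  linear_combination -hs

theorem one_sub_boundB_sq (α ν : ℝ) {x : ℝ} (hx : 0 < x) :
    1 - boundB α ν x ^ 2 = 2 * delta α ν x / x * boundB α ν x := by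
  have hs := Real.sq_sqrt (show 0 ≤ delta α ν x ^ 2 + x ^ 2 by positivity)
  rw [boundB_eq α ν hx]
  field_simp
  linear_combination -hs

/-- Up to the factor `x / B_α(ν, x)`, the amount by which `B_α(ν, ·)` fails to satisfy the
Riccati equation of `besselRatio ν`. -/
noncomputable def boundDefect (α ν x : ℝ) : ℝ :=
  (ν - 1 / 2 + lam α ν / √(lam α ν ^ 2 + x ^ 2) - (lam α ν / √(lam α ν ^ 2 + x ^ 2)) ^ 3 / 2)
    / √(delta α ν x ^ 2 + x ^ 2) - lam α ν / √(lam α ν ^ 2 + x ^ 2)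

/-- B = exp(-arsinh(δ/x)), so xB'/B = (δ - xδ')/√(δ² + x²); with c = λ/√(λ² + x²), the numerator is
ν - 1/2 + c - c³/2. -/
theorem hasDerivAt_boundB (α ν : ℝ) {x : ℝ} (hx : 0 < x) :
    HasDerivAt (boundB α ν)
      (1 - (2 * ν - 1) / x * boundB α ν x - boundB α ν x ^ 2
        + boundB α ν x / x * boundDefect α ν x) x := by
  set r := √(lam α ν ^ 2 + x ^ 2) with hr
  set s := √(delta α ν x ^ 2 + x ^ 2) with hs
  have hr0 : 0 < lam α ν ^ 2 + x ^ 2 := by positivity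
  have hs0 : 0 < delta α ν x ^ 2 + x ^ 2 := by positivity
  have hrp : 0 < r := Real.sqrt_pos.2 hr0
  have hsp : 0 < s := Real.sqrt_pos.2 hs0
  have hr2 : r ^ 2 = lam α ν ^ 2 + x ^ 2 := Real.sq_sqrt hr0.le
  have hs2 : s ^ 2 = delta α ν x ^ 2 + x ^ 2 := Real.sq_sqrt hs0.le
  have hsq : HasDerivAt (fun y : ℝ => y ^ 2) (2 * x) x := by
    simpa using hasDerivAt_pow 2 x
  have dr : HasDerivAt (fun y => √(lam α ν ^ 2 + y ^ 2)) (2 * x / (2 * r)) x :=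
    (hsq.const_add _).sqrt hr0.ne'
  set e := -(lam α ν * x) / (2 * r ^ 3) with he
  have dδ : HasDerivAt (delta α ν) e x := by
    refine HasDerivAt.congr_deriv
      (((hasDerivAt_const x (lam α ν)).div (dr.const_mul 2) (by positivity)).const_add
        (ν - 1 / 2)) ?_
    simp only [← hr, he]
    field_simp
    ring
  have ds : HasDerivAt (fun y => √(delta α ν y ^ 2 + y ^ 2))
      ((2 * delta α ν x * e + 2 * x) / (2 * s)) x := by
    refine HasDerivAt.congr_deriv (((dδ.pow 2).add hsq).sqrt hs0.ne') ?_
    simp only [Pi.add_apply, Pi.pow_apply, ← hs]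
    norm_num
  have dB := (ds.sub dδ).div (hasDerivAt_id x) hx.ne'
  have heq : boundB α ν =ᶠ[𝓝 x] fun y => (√(delta α ν y ^ 2 + y ^ 2) - delta α ν y) / y := by
    filter_upwards [lt_mem_nhds hx] with y hy using boundB_eq α ν hy
  refine HasDerivAt.congr_of_eventuallyEq (HasDerivAt.congr_deriv dB ?_) heq
  have h1 := one_sub_boundB_sq α ν hx
  have hδ := delta_eq α ν x
  rw [← hr] at hδ
  have h3 : 1 - (2 * ν - 1) / x * boundB α ν x - boundB α ν x ^ 2
        + boundB α ν x / x * boundDefect α ν x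
      = boundB α ν x / x * (2 * delta α ν x - (2 * ν - 1) + boundDefect α ν x) := by
    linear_combination h1
  have h4 : 2 * delta α ν x - (2 * ν - 1) + boundDefect α ν x = (delta α ν x - x * e) / s := by
    have h5 : ν - 1 / 2 + lam α ν / r - (lam α ν / r) ^ 3 / 2 = delta α ν x - x * e := by
      rw [hδ, he]
      field_simp
      linear_combination lam α ν * hr2
    rw [boundDefect, ← hr, ← hs, h5, hδ]
    ring
  rw [h3, h4, boundB_eq α ν hx, ← hs]
  simp only [Pi.sub_apply, id, ← hs]
  field_simp
  linear_combination (-1) * hs2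

theorem div_sqrt_sq_mul_sq (l : ℝ) {x : ℝ} (hx : 0 < x) :
    (l / √(l ^ 2 + x ^ 2)) ^ 2 * x ^ 2 = l ^ 2 * (1 - (l / √(l ^ 2 + x ^ 2)) ^ 2) := by
  have h0 : 0 < l ^ 2 + x ^ 2 := by positivity
  rw [div_pow, Real.sq_sqrt h0.le]
  field_simp
  ring

theorem div_sqrt_lt_one (l : ℝ) {x : ℝ} (hx : 0 < x) : l / √(l ^ 2 + x ^ 2) < 1 := by
  have h0 : 0 < l ^ 2 + x ^ 2 := by positivity
  rw [div_lt_one (Real.sqrt_pos.2 h0)]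
  refine (le_abs_self l).trans_lt (Real.lt_sqrt_of_sq_lt (by rw [sq_abs]; nlinarith))

theorem boundDefect_zero_pos {ν x : ℝ} (hν : 1 / 2 < ν) (hx : 0 < x) :
    0 < boundDefect 0 ν x := by
  have hl : lam 0 ν = ν - 1 / 2 := by rw [lam]; ring
  have hδ := delta_eq 0 ν x
  have hc2 := div_sqrt_sq_mul_sq (lam 0 ν) hx
  have hc1 := div_sqrt_lt_one (lam 0 ν) hx
  have hc0 : 0 < lam 0 ν / √(lam 0 ν ^ 2 + x ^ 2) :=
    div_pos (by linarith) (Real.sqrt_pos.2 (by positivity))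
  rw [boundDefect]
  set c := lam 0 ν / √(lam 0 ν ^ 2 + x ^ 2)
  have hs0 : 0 < delta 0 ν x ^ 2 + x ^ 2 := by positivity
  have hsp := Real.sqrt_pos.2 hs0
  have hs2 := Real.sq_sqrt hs0.le
  set s := √(delta 0 ν x ^ 2 + x ^ 2)
  rw [sub_pos, lt_div_iff₀ hsp]
  rw [hl] at hc2
  have ha : 0 < ν - 1 / 2 := by linarith
  set a := ν - 1 / 2
  have hc3 : 0 < 1 - c ^ 2 := by nlinarith
  refine lt_of_pow_lt_pow_left₀ 2 (by nlinarith [mul_pos hc0 hc3]) ?_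
  -- Here λ = a, so c²x² = a²(1 - c²) eliminates x and 1 - c² factors out.
  have e : (a + c - c ^ 3 / 2) ^ 2 - (c * s) ^ 2
      = (1 - c ^ 2) * (2 * a * c + c ^ 2 * (1 - c ^ 2 / 4)) := by
    rw [mul_pow, hs2, hδ]
    linear_combination -hc2
  have : 0 < (1 - c ^ 2) * (2 * a * c + c ^ 2 * (1 - c ^ 2 / 4)) := by
    have : 0 < 1 - c ^ 2 / 4 := by nlinarith
    positivity
  linarith

theorem boundDefect_two_neg {ν x : ℝ} (hν : 0 ≤ ν) (hx : 0 < x) :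
    boundDefect 2 ν x < 0 := by
  have hl : lam 2 ν = ν - 1 / 2 + 1 := by rw [lam]; ring
  have hδ := delta_eq 2 ν x
  have hc2 := div_sqrt_sq_mul_sq (lam 2 ν) hx
  have hc1 := div_sqrt_lt_one (lam 2 ν) hx
  have hc0 : 0 < lam 2 ν / √(lam 2 ν ^ 2 + x ^ 2) :=
    div_pos (by linarith) (Real.sqrt_pos.2 (by positivity))
  rw [boundDefect]
  set c := lam 2 ν / √(lam 2 ν ^ 2 + x ^ 2)
  have hs0 : 0 < delta 2 ν x ^ 2 + x ^ 2 := by positivity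
  have hsp := Real.sqrt_pos.2 hs0
  have hs2 := Real.sq_sqrt hs0.le
  set s := √(delta 2 ν x ^ 2 + x ^ 2)
  rw [sub_neg, div_lt_iff₀ hsp]
  rw [hl] at hc2
  have ha : -(1 / 2) ≤ ν - 1 / 2 := by linarith
  set a := ν - 1 / 2
  have hc3 : 0 < 1 - c ^ 2 := by nlinarith
  refine lt_of_pow_lt_pow_left₀ 2 (by positivity) ?_
  -- Now λ = a + 1; the second factor is positive because 2a + 1 = 2ν ≥ 0.
  have e : (c * s) ^ 2 - (a + c - c ^ 3 / 2) ^ 2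
      = (1 - c ^ 2) * ((1 - c) * (2 * a + 1 + c) + c ^ 4 / 4) := by
    rw [mul_pow, hs2, hδ]
    linear_combination hc2
  have : 0 < (1 - c ^ 2) * ((1 - c) * (2 * a + 1 + c) + c ^ 4 / 4) := by
    have h1 : 0 < 1 - c := by linarith
    have h2 : 0 < 2 * a + 1 + c := by linarith
    positivity
  linarith

/-- Both y ↦ y/√(y² + x²) and y ↦ y + √(y² + x²) increase strictly, so the denominator of B_α
increases with α. -/
theorem strictAnti_boundB (ν : ℝ) {x : ℝ} (hx : 0 < x) :
    StrictAnti fun α => boundB α ν x := by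
  have h0 : ∀ y : ℝ, 0 < y ^ 2 + x ^ 2 := fun y => by positivity
  have hd : ∀ y : ℝ, HasDerivAt (fun y : ℝ => √(y ^ 2 + x ^ 2)) (y / √(y ^ 2 + x ^ 2)) y := by
    intro y
    have h1 : HasDerivAt (fun y : ℝ => y ^ 2 + x ^ 2) (2 * y) y := by
      simpa using (hasDerivAt_pow 2 y).add_const (x ^ 2)
    refine (h1.sqrt (h0 y).ne').congr_deriv ?_
    rw [mul_div_mul_left _ _ two_ne_zero]
  have m1 : StrictMono fun y : ℝ => y / √(y ^ 2 + x ^ 2) := by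
    refine strictMono_of_hasDerivAt_pos (fun y => (hasDerivAt_id y).div (hd y)
      (Real.sqrt_pos.2 (h0 y)).ne') fun y => ?_
    have hp := Real.sqrt_pos.2 (h0 y)
    have hs := Real.sq_sqrt (h0 y).le
    refine div_pos ?_ (by positivity)
    have : (1 * √(y ^ 2 + x ^ 2) - id y * (y / √(y ^ 2 + x ^ 2))) = x ^ 2 / √(y ^ 2 + x ^ 2) := by
      simp only [id]
      field_simp
      linarith
    rw [this]
    positivity
  have m2 : StrictMono fun y : ℝ => y + √(y ^ 2 + x ^ 2) := by
    refine strictMono_of_hasDerivAt_pos (fun y => (hasDerivAt_id y).add (hd y)) fun y => ?_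
    have hp := Real.sqrt_pos.2 (h0 y)
    have := add_sqrt_sq_add_sq_pos y hx
    rw [show 1 + y / √(y ^ 2 + x ^ 2) = (y + √(y ^ 2 + x ^ 2)) / √(y ^ 2 + x ^ 2) by
      field_simp; ring]
    positivity
  intro α β hαβ
  have h1 : lam α ν < lam β ν := by rw [lam, lam]; linarith
  have h2 : delta α ν x < delta β ν x := by
    rw [delta_eq, delta_eq]
    have := m1 h1
    simp only at this
    linarith
  exact div_lt_div_of_pos_left hx (add_sqrt_sq_add_sq_pos _ hx) (m2 h2)

/-! ### Comparison principle -/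

theorem HasDerivAt.eventually_lt_left {g : ℝ → ℝ} {g' x : ℝ} (h : HasDerivAt g g' x)
    (hg' : 0 < g') : ∀ᶠ y in 𝓝[<] x, g y < g x := by
  have h1 := (hasDerivAt_iff_tendsto_slope.1 h).eventually (lt_mem_nhds hg')
  have h2 : 𝓝[<] x ≤ 𝓝[≠] x := nhdsWithin_mono _ fun y hy => ne_of_lt hy
  filter_upwards [h2 h1, self_mem_nhdsWithin] with y hy hyx
  have hyx' : y - x < 0 := sub_neg.2 hyx
  rw [slope_def_field, div_eq_mul_inv] at hy
  have := neg_of_mul_pos_left hy (inv_lt_zero.2 hyx').le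
  linarith

/-- A function on `(0, ∞)` that increases wherever it is nonpositive, and whose lower limit at `0`
is nonnegative, is positive. -/
theorem pos_of_deriv_pos_of_nonpos {g g' : ℝ → ℝ} (hg : ∀ x, 0 < x → HasDerivAt g (g' x) x)
    (hg' : ∀ x, 0 < x → g x ≤ 0 → 0 < g' x)
    (h0 : ∀ ε, 0 < ε → ∀ᶠ x in 𝓝[>] (0 : ℝ), -ε < g x) {x : ℝ} (hx : 0 < x) : 0 < g x := by
  by_contra! hle
  obtain ⟨y, hy, hy0⟩ := (((hg x hx).eventually_lt_left (hg' x hx hle)).and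
    (Ioo_mem_nhdsLT hx)).exists
  have hyneg : g y < 0 := hy.trans_le hle
  -- A minimum over [z, y] cannot lie to the right of z, as g is smaller just to the left of such a
  -- point. So g stays below g y < 0 down to 0.
  have key : ∀ z, 0 < z → z < y → g z ≤ g y := by
    intro z hz hzy
    obtain ⟨m, hm, hmin⟩ := isCompact_Icc.exists_isMinOn (nonempty_Icc.2 hzy.le)
      (fun w hw => (hg w (hz.trans_le hw.1)).continuousAt.continuousWithinAt)
    have hmy : g m ≤ g y := hmin (right_mem_Icc.2 hzy.le)
    rcases hm.1.eq_or_lt with rfl | hzm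
    · exact hmy
    have hm0 : 0 < m := hz.trans hzm
    obtain ⟨w, hw, hwz, hwm⟩ := (((hg m hm0).eventually_lt_left
      (hg' m hm0 (hmy.trans hyneg.le))).and (Ioo_mem_nhdsLT hzm)).exists
    exact absurd hw (not_lt.2 (hmin ⟨hwz.le, hwm.le.trans hm.2⟩))
  obtain ⟨z, hz, hz0, hzy⟩ := ((h0 (-g y) (by linarith)).and (Ioo_mem_nhdsGT hy0.1)).exists
  linarith [key z hz0 hzy]

/-- A positive strict supersolution of the Riccati equation lies above the ratio. -/
theorem besselRatio_lt_of_supersolution {ν : ℝ} (hν : 1 / 2 ≤ ν) {u u' : ℝ → ℝ}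
    (hu : ∀ x, 0 < x → HasDerivAt u (u' x) x) (hpos : ∀ x, 0 < x → 0 < u x)
    (hsup : ∀ x, 0 < x → 1 - (2 * ν - 1) / x * u x - u x ^ 2 < u' x) {x : ℝ} (hx : 0 < x) :
    besselRatio ν x < u x := by
  have hν0 : 0 < ν := by linarith
  refine sub_pos.1 (pos_of_deriv_pos_of_nonpos (g := fun y => u y - besselRatio ν y)
    (fun y hy => (hu y hy).sub (hasDerivAt_besselRatio hν0 hy)) (fun y hy hle => ?_)
    (fun ε hε => ?_) hx)
  -- This sign is where ν ≥ 1/2 enters.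
  · have h1 : 0 ≤ (2 * ν - 1) / y := div_nonneg (by linarith) hy.le
    have h2 := hpos y hy
    have h3 := besselRatio_pos hν0 hy
    have h4 := hsup y hy
    have : ((2 * ν - 1) / y + (u y + besselRatio ν y)) * (u y - besselRatio ν y) ≤ 0 :=
      mul_nonpos_of_nonneg_of_nonpos (by positivity) hle
    linarith
  · filter_upwards [Ioo_mem_nhdsGT (show 0 < 2 * ν * ε by positivity)] with y hy
    have h1 := besselRatio_le hν0 hy.1
    have h2 : y / (2 * ν) < ε := by
      rw [div_lt_iff₀ (by positivity)]
      linarith [hy.2]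
    linarith [hpos y hy.1]

/-! ### The two bounds -/

theorem besselRatio_lt_boundB {ν x : ℝ} (hν : 1 / 2 ≤ ν) (hx : 0 < x) :
    besselRatio ν x < boundB 0 ν x := by
  rcases hν.eq_or_lt with rfl | hν'
  · have hB : boundB 0 (1 / 2) x = 1 := by
      rw [boundB, delta, lam]
      norm_num [Real.sqrt_sq hx.le, hx.ne']
    rw [hB]
    -- The constant 1 is not a strict supersolution; 1 - exp(-2y) is, and lies below it.
    have := besselRatio_lt_of_supersolution le_rfl (u := fun y => 1 - Real.exp (-2 * y))
      (fun y _ => (((hasDerivAt_id y).const_mul (-2)).exp).const_sub 1)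
      (fun y hy => by simpa using hy) (fun y _ => ?_) hx
    · linarith [Real.exp_pos (-2 * x)]
    · have := Real.exp_pos (-2 * y)
      simp only [id]
      norm_num
      norm_num at this
      nlinarith
  · refine besselRatio_lt_of_supersolution hν (fun y hy => hasDerivAt_boundB 0 ν hy)
      (fun y hy => boundB_pos 0 ν hy) (fun y hy => ?_) hx
    have := mul_pos (div_pos (boundB_pos 0 ν hy) hy) (boundDefect_zero_pos hν' hy)
    linarith

theorem continuousAt_delta_zero {α ν : ℝ} (hl : 0 < lam α ν) :
    ContinuousAt (fun x => delta α ν x) 0 := by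
  unfold delta
  refine ContinuousAt.add continuousAt_const (ContinuousAt.div continuousAt_const ?_ ?_)
  · fun_prop
  · have : 0 < √(lam α ν ^ 2 + 0 ^ 2) := Real.sqrt_pos.2 (by positivity)
    positivity

theorem delta_at_zero {α ν : ℝ} (hl : 0 < lam α ν) : delta α ν 0 = ν := by
  rw [delta, zero_pow two_ne_zero, add_zero, Real.sqrt_sq hl.le]
  field_simp
  ring

theorem tendsto_delta_add_sqrt_zero {α ν : ℝ} (hν : 0 ≤ ν) (hl : 0 < lam α ν) :
    Tendsto (fun x => delta α ν x + √(delta α ν x ^ 2 + x ^ 2)) (𝓝[>] 0) (𝓝 (2 * ν)) := by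
  have hc := continuousAt_delta_zero hl
  have : ContinuousAt (fun x => delta α ν x + √(delta α ν x ^ 2 + x ^ 2)) 0 := by fun_prop
  have ht := this.tendsto
  simp only [delta_at_zero hl, zero_pow two_ne_zero, add_zero, Real.sqrt_sq hν] at ht
  rw [two_mul]
  exact ht.mono_left nhdsWithin_le_nhds

/-- The integrating factor y^(2ν-1) removes the linear Riccati term, whose sign is wrong for ν <
1/2. The weighted bound still tends to 0 at 0, like y^(2ν)/(2ν). -/
theorem boundB_lt_besselRatio_of_pos {ν x : ℝ} (hν : 0 < ν) (hx : 0 < x) :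
    boundB 2 ν x < besselRatio ν x := by
  have key := pos_of_deriv_pos_of_nonpos
    (g := fun y => y ^ (2 * ν - 1) * (besselRatio ν y - boundB 2 ν y))
    (fun y hy => (Real.hasDerivAt_rpow_const (Or.inl hy.ne')).mul
      ((hasDerivAt_besselRatio hν hy).sub (hasDerivAt_boundB 2 ν hy)))
    (fun y hy hle => ?_) (fun ε hε => ?_) hx
  · exact sub_pos.1 (pos_of_mul_pos_right key (Real.rpow_nonneg hx.le _))
  · have hp := Real.rpow_pos_of_pos hy (2 * ν - 1)
    have hle' := nonpos_of_mul_nonpos_right hle hp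
    have e : y ^ (2 * ν - 1 - 1) = y ^ (2 * ν - 1) / y := Real.rpow_sub_one hy.ne' _
    have hB := boundB_pos 2 ν hy
    have h1 := mul_neg_of_pos_of_neg (div_pos hB hy) (boundDefect_two_neg hν.le hy)
    have h2 := mul_nonpos_of_nonneg_of_nonpos
      (add_pos (besselRatio_pos hν hy) hB).le hle'
    rw [e]
    have : 0 < y ^ (2 * ν - 1) * (-(boundB 2 ν y / y * boundDefect 2 ν y)
        - (besselRatio ν y + boundB 2 ν y) * (besselRatio ν y - boundB 2 ν y)) :=
      mul_pos hp (by linarith)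
    calc _ < _ := this
      _ = _ := by ring
  · have hl : 0 < lam 2 ν := by rw [lam]; linarith
    have h1 : Tendsto (fun y : ℝ => y ^ (2 * ν)) (𝓝[>] 0) (𝓝 0) := by
      have := (Real.continuous_rpow_const (show 0 ≤ 2 * ν by linarith)).tendsto 0
      rw [Real.zero_rpow (by linarith)] at this
      exact this.mono_left nhdsWithin_le_nhds
    have h2 := h1.div (tendsto_delta_add_sqrt_zero hν.le hl) (by linarith)
    rw [zero_div] at h2
    filter_upwards [h2.eventually (gt_mem_nhds hε), self_mem_nhdsWithin] with y hy hy0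
    have hy0 : 0 < y := hy0
    have hp := Real.rpow_pos_of_pos hy0 (2 * ν - 1)
    have e : y ^ (2 * ν - 1) * boundB 2 ν y
        = y ^ (2 * ν) / (delta 2 ν y + √(delta 2 ν y ^ 2 + y ^ 2)) := by
      rw [boundB, Real.rpow_sub_one hy0.ne']
      field_simp
    have h3 := mul_pos hp (besselRatio_pos hν hy0)
    rw [mul_sub, e]
    simp only [Pi.div_apply] at hy
    linarith

/-- Since I_{-1} = I_1, the ratio at ν = 0 is the reciprocal of that at ν = 1. Both bounds have λ =
1/2, so 1/B_0(1, x) and B_2(0, x) compare directly. -/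
theorem boundB_lt_besselRatio_zero {x : ℝ} (hx : 0 < x) : boundB 2 0 x < besselRatio 0 x := by
  have h1 := besselRatio_lt_boundB (show (1 : ℝ) / 2 ≤ 1 by norm_num) hx
  have h1p := besselRatio_pos one_pos hx
  have e : besselRatio 0 x = (besselRatio 1 x)⁻¹ := by
    rw [besselRatio, besselRatio, inv_div, zero_sub, besselI_neg_one hx, sub_self]
  rw [e]
  refine lt_trans ?_ (inv_strictAnti₀ h1p h1)
  rw [boundB_eq 2 0 hx, boundB, inv_div]
  have hr : 0 < √((1 / 2) ^ 2 + x ^ 2) := Real.sqrt_pos.2 (by positivity)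
  have d0 : delta 2 0 x = -(1 / 2) + (1 / 4) / √((1 / 2) ^ 2 + x ^ 2) := by
    rw [delta, lam, show (0 : ℝ) + (2 - 1) / 2 = 1 / 2 by norm_num]
    field_simp
    ring
  have d1 : delta 0 1 x = 1 / 2 + (1 / 4) / √((1 / 2) ^ 2 + x ^ 2) := by
    rw [delta, lam, show (1 : ℝ) + (0 - 1) / 2 = 1 / 2 by norm_num]
    field_simp
    ring
  have hm : 1 / 4 / √((1 / 2) ^ 2 + x ^ 2) < 1 / 2 := by
    have : (1 / 2 : ℝ) < √((1 / 2) ^ 2 + x ^ 2) := Real.lt_sqrt_of_sq_lt (by nlinarith)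
    rw [div_lt_iff₀ hr]
    linarith
  have hq : 0 < 1 / 4 / √((1 / 2) ^ 2 + x ^ 2) := by positivity
  rw [d0, d1]
  set q := 1 / 4 / √((1 / 2) ^ 2 + x ^ 2)
  have hs : √((-(1 / 2) + q) ^ 2 + x ^ 2) ≤ √((1 / 2 + q) ^ 2 + x ^ 2) :=
    Real.sqrt_le_sqrt (by nlinarith)
  gcongr ?_ / x
  linarith

theorem boundB_lt_besselRatio {ν x : ℝ} (hν : 0 ≤ ν) (hx : 0 < x) :
    boundB 2 ν x < besselRatio ν x := by
  rcases hν.eq_or_lt with rfl | hν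
  · exact boundB_lt_besselRatio_zero hx
  · exact boundB_lt_besselRatio_of_pos hν hx

/-! ### Optimality: behaviour at 0 and at infinity -/

/-- Near 0, x/R - x/B_α is asymptotic to x²·(1/(2(ν+1)) + 1/(2λ²) - 1/(2ν)), whose coefficient is
positive exactly when λ² < ν(ν+1). -/
theorem exists_besselRatio_lt_boundB {α ν : ℝ} (hν : 0 < ν) (hl : 0 < lam α ν)
    (h : lam α ν ^ 2 < ν * (ν + 1)) : ∃ x, 0 < x ∧ besselRatio ν x < boundB α ν x := by
  have hsq : Tendsto (fun x : ℝ => x ^ 2 / 4) (𝓝[>] 0) (𝓝 0) := by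
    have : Continuous fun x : ℝ => x ^ 2 / 4 := by fun_prop
    simpa using (this.tendsto 0).mono_left nhdsWithin_le_nhds
  have hser : ∀ μ : ℝ, -1 < μ → Tendsto (fun x : ℝ => besselSeries μ (x ^ 2 / 4)) (𝓝[>] 0)
      (𝓝 (Real.Gamma (μ + 1))⁻¹) := fun μ hμ => by
    rw [← besselSeries_zero]
    exact (hasDerivAt_besselSeries hμ 0).continuousAt.tendsto.comp hsq
  have hG : Real.Gamma (ν + 1) ≠ 0 := (Real.Gamma_pos_of_pos (by linarith)).ne'
  have t1 := (hser (ν + 1) (by linarith)).div ((hser ν (by linarith)).const_mul 2)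
    (mul_ne_zero two_ne_zero (inv_ne_zero hG))
  have t2 : Tendsto (fun x : ℝ => (√(lam α ν ^ 2 + x ^ 2) * (√(lam α ν ^ 2 + x ^ 2) + lam α ν))⁻¹)
      (𝓝[>] 0) (𝓝 (2 * lam α ν ^ 2)⁻¹) := by
    refine Tendsto.inv₀ ?_ (by positivity)
    have : Continuous fun x : ℝ => √(lam α ν ^ 2 + x ^ 2) * (√(lam α ν ^ 2 + x ^ 2) + lam α ν) := by
      fun_prop
    have ht := this.tendsto 0
    simp only [zero_pow two_ne_zero, add_zero, Real.sqrt_sq hl.le] at ht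
    rw [show 2 * lam α ν ^ 2 = lam α ν * (lam α ν + lam α ν) by ring]
    exact ht.mono_left nhdsWithin_le_nhds
  have t3 := (tendsto_delta_add_sqrt_zero hν.le hl).inv₀ (by positivity)
  have hlim : 0 < (Real.Gamma (ν + 1 + 1))⁻¹ / (2 * (Real.Gamma (ν + 1))⁻¹)
      + (2 * lam α ν ^ 2)⁻¹ - (2 * ν)⁻¹ := by
    have e : (Real.Gamma (ν + 1 + 1))⁻¹ / (2 * (Real.Gamma (ν + 1))⁻¹) = (2 * (ν + 1))⁻¹ := by
      rw [Real.Gamma_add_one (s := ν + 1) (by positivity)]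
      field_simp
    have e2 : (2 * ν)⁻¹ - (2 * (ν + 1))⁻¹ = (2 * (ν * (ν + 1)))⁻¹ := by
      field_simp
      ring
    have : (2 * (ν * (ν + 1)))⁻¹ < (2 * lam α ν ^ 2)⁻¹ :=
      inv_strictAnti₀ (by positivity) (by linarith)
    rw [e]
    linarith
  obtain ⟨x, hx, hx0⟩ :=
    ((((t1.add t2).sub t3).eventually (lt_mem_nhds hlim)).and self_mem_nhdsWithin).exists
  have hx0 : 0 < x := hx0
  refine ⟨x, hx0, ?_⟩
  have hr0 : 0 < lam α ν ^ 2 + x ^ 2 := by positivity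
  have hs0 : 0 < delta α ν x ^ 2 + x ^ 2 := by positivity
  have hp := add_sqrt_sq_add_sq_pos (delta α ν x) hx0
  have hrp := Real.sqrt_pos.2 hr0
  have hr2 := Real.sq_sqrt hr0.le
  have hs2 := Real.sq_sqrt hs0.le
  have hR := besselRatio_pos hν hx0
  have key : delta α ν x + √(delta α ν x ^ 2 + x ^ 2) < x / besselRatio ν x := by
    have e1 : delta α ν x = ν - x ^ 2 *
        (√(lam α ν ^ 2 + x ^ 2) * (√(lam α ν ^ 2 + x ^ 2) + lam α ν))⁻¹ / 2 := by
      have : (√(lam α ν ^ 2 + x ^ 2) + lam α ν) ≠ 0 := by positivity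
      rw [delta_eq]
      set r := √(lam α ν ^ 2 + x ^ 2)
      rw [show x ^ 2 = (r - lam α ν) * (r + lam α ν) by linear_combination -hr2]
      field_simp
      ring
    have e2 : √(delta α ν x ^ 2 + x ^ 2) - delta α ν x
        = x ^ 2 * (delta α ν x + √(delta α ν x ^ 2 + x ^ 2))⁻¹ := by
      rw [← div_eq_mul_inv, eq_div_iff hp.ne']
      linear_combination hs2
    rw [div_besselRatio hν hx0]
    have := mul_pos (pow_pos hx0 2) hx
    simp only [Pi.div_apply] at this
    rw [mul_sub, mul_add, ← e2] at this
    linarith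
  rw [boundB]
  rw [lt_div_iff₀ hR] at key
  rw [lt_div_iff₀ hp]
  linarith

theorem tendsto_div_sqrt_sq_add_sq_atTop (l : ℝ) :
    Tendsto (fun x : ℝ => x / √(l ^ 2 + x ^ 2)) atTop (𝓝 1) := by
  have h1 : Tendsto (fun x : ℝ => √((l / x) ^ 2 + 1)) atTop (𝓝 1) := by
    have h0 : Tendsto (fun x : ℝ => l / x) atTop (𝓝 0) := tendsto_const_nhds.div_atTop tendsto_id
    simpa using ((h0.pow 2).add_const 1).sqrt
  have h2 := h1.inv₀ one_ne_zero
  rw [inv_one] at h2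
  refine h2.congr' ?_
  filter_upwards [eventually_gt_atTop 0] with x hx
  have : l ^ 2 + x ^ 2 = ((l / x) ^ 2 + 1) * x ^ 2 := by field_simp
  rw [this, Real.sqrt_mul (by positivity), Real.sqrt_sq hx.le]
  field_simp

theorem tendsto_delta_atTop (α ν : ℝ) : Tendsto (delta α ν) atTop (𝓝 (ν - 1 / 2)) := by
  have h := ((tendsto_div_sqrt_sq_add_sq_atTop (lam α ν)).mul
    (tendsto_const_nhds (x := lam α ν).div_atTop tendsto_id)).div_const 2
  have h' := h.const_add (ν - 1 / 2)
  simp only [mul_zero, zero_div, add_zero] at h'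
  refine h'.congr' ?_
  filter_upwards [eventually_gt_atTop 0] with x hx
  rw [delta_eq]
  simp only [id]
  field_simp

theorem tendsto_div_sqrt_delta_atTop (α ν : ℝ) :
    Tendsto (fun x => x / √(delta α ν x ^ 2 + x ^ 2)) atTop (𝓝 1) := by
  have h0 := (tendsto_delta_atTop α ν).div_atTop tendsto_id
  have h1 := ((h0.pow 2).add_const 1).sqrt.inv₀ (by norm_num)
  norm_num at h1
  refine h1.congr' ?_
  filter_upwards [eventually_gt_atTop 0] with x hx
  have : delta α ν x ^ 2 + x ^ 2 = ((delta α ν x / x) ^ 2 + 1) * x ^ 2 := by field_simp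
  rw [this, Real.sqrt_mul (by positivity), Real.sqrt_sq hx.le]
  field_simp

theorem tendsto_boundB_atTop (α ν : ℝ) : Tendsto (boundB α ν) atTop (𝓝 1) := by
  have h1 := ((tendsto_div_sqrt_delta_atTop α ν).inv₀ one_ne_zero).sub
    ((tendsto_delta_atTop α ν).div_atTop tendsto_id)
  norm_num at h1
  refine h1.congr' ?_
  filter_upwards [eventually_gt_atTop 0] with x hx
  rw [boundB_eq α ν hx, sub_div]

theorem tendsto_mul_boundDefect_atTop (α ν : ℝ) :
    Tendsto (fun x => x * boundDefect α ν x) atTop (𝓝 (-(α / 2))) := by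
  have hr := tendsto_div_sqrt_sq_add_sq_atTop (lam α ν)
  have hc : Tendsto (fun x => lam α ν / √(lam α ν ^ 2 + x ^ 2)) atTop (𝓝 0) := by
    have := hr.mul (tendsto_const_nhds (x := lam α ν).div_atTop tendsto_id)
    rw [mul_zero] at this
    refine this.congr' ?_
    filter_upwards [eventually_gt_atTop 0] with x hx
    simp only [id]
    field_simp
  have h := ((((hc.const_add (ν - 1 / 2)).sub ((hc.pow 3).div_const 2)).mul
    (tendsto_div_sqrt_delta_atTop α ν))).sub (hr.const_mul (lam α ν))
  have e : (ν - 1 / 2 + 0 - 0 ^ 3 / 2) * 1 - lam α ν * 1 = -(α / 2) := by rw [lam]; ring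
  rw [e] at h
  refine h.congr fun x => ?_
  rw [boundDefect]
  ring

/-- If w = B_α - R stayed nonnegative, the damping coefficient of its equation would eventually
exceed 1/2, so w·exp(x/2) would have derivative at most -α/64 and turn negative. -/
theorem exists_boundB_lt_besselRatio {α ν : ℝ} (hα : 0 < α) (hν : 1 / 2 ≤ ν) :
    ∃ x, 0 < x ∧ boundB α ν x < besselRatio ν x := by
  by_contra! hle
  have hν0 : 0 < ν := by linarith
  obtain ⟨X, hX⟩ := eventually_atTop.1
    (((tendsto_mul_boundDefect_atTop α ν).eventually
      (gt_mem_nhds (show -(α / 2) < -(α / 4) by linarith))).and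
    (((tendsto_boundB_atTop α ν).eventually (lt_mem_nhds (show (1 / 2 : ℝ) < 1 by norm_num))).and
    (eventually_gt_atTop 0)))
  have hX0 : 0 < X := (hX X le_rfl).2.2
  set u' : ℝ → ℝ := fun x => ((1 - (2 * ν - 1) / x * boundB α ν x - boundB α ν x ^ 2
        + boundB α ν x / x * boundDefect α ν x)
      - (1 - (2 * ν - 1) / x * besselRatio ν x - besselRatio ν x ^ 2)) * Real.exp (x / 2)
      + (boundB α ν x - besselRatio ν x) * (Real.exp (x / 2) * (1 / 2)) with hu'
  have hu : ∀ x, 0 < x → HasDerivAt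
      (fun y => (boundB α ν y - besselRatio ν y) * Real.exp (y / 2)) (u' x) x := fun x hx =>
    ((hasDerivAt_boundB α ν hx).sub (hasDerivAt_besselRatio hν0 hx)).mul
      (((hasDerivAt_id x).div_const 2).exp)
  have hbound : ∀ x, X ≤ x → u' x ≤ -(α / 64) := by
    intro x hXx
    obtain ⟨h1, h2, hx⟩ := hX x hXx
    have hR := besselRatio_pos hν0 hx
    have he := sub_nonneg.2 (hle x hx)
    set B := boundB α ν x
    set R := besselRatio ν x
    set D := boundDefect α ν x
    have hexp : x ^ 2 / 8 ≤ Real.exp (x / 2) := by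
      have := Real.quadratic_le_exp_of_nonneg (show 0 ≤ x / 2 by positivity)
      nlinarith
    have h3 : B / x * D ≤ -(α / 8) / x ^ 2 := by
      rw [le_div_iff₀ (by positivity), show B / x * D * x ^ 2 = B * (x * D) by field_simp]
      nlinarith
    have h4 : 0 ≤ ((2 * ν - 1) / x + (B - 1 / 2) + R) * (B - R) := by
      have : 0 ≤ (2 * ν - 1) / x := div_nonneg (by linarith) hx.le
      exact mul_nonneg (by linarith) he
    calc u' x = (B / x * D - ((2 * ν - 1) / x + (B - 1 / 2) + R) * (B - R))
          * Real.exp (x / 2) := by simp only [hu']; ring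
      _ ≤ (-(α / 8) / x ^ 2) * Real.exp (x / 2) := by
          gcongr
          linarith
      _ ≤ (-(α / 8) / x ^ 2) * (x ^ 2 / 8) := by
          refine mul_le_mul_of_nonpos_left hexp ?_
          rw [neg_div]
          exact neg_nonpos.2 (by positivity)
      _ = -(α / 64) := by field_simp; norm_num
  set U := (boundB α ν X - besselRatio ν X) * Real.exp (X / 2) with hU
  have hU0 : 0 ≤ U := mul_nonneg (sub_nonneg.2 (hle X hX0)) (Real.exp_pos _).le
  -- Long enough for slope -α/64 to bring U down to -α/64 < 0.
  set Y := X + (64 * U / α + 1) with hY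
  have hpos : 0 < 64 * U / α + 1 := by positivity
  have hXY : X < Y := by linarith
  obtain ⟨c, hc, hce⟩ := exists_hasDerivAt_eq_slope _ u' hXY
    (fun y hy => (hu y (hX0.trans_le hy.1)).continuousAt.continuousWithinAt)
    (fun y hy => hu y (hX0.trans hy.1))
  have h1 := hbound c hc.1.le
  have hY0 : 0 ≤ (boundB α ν Y - besselRatio ν Y) * Real.exp (Y / 2) :=
    mul_nonneg (sub_nonneg.2 (hle Y (hX0.trans hXY))) (Real.exp_pos _).le
  rw [hce, div_le_iff₀ (by linarith), ← hU, show Y - X = 64 * U / α + 1 by rw [hY]; ring] at h1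
  have e : -(α / 64) * (64 * U / α + 1) = -U - α / 64 := by field_simp; ring
  linarith

/-- The inequality reads (α-1)²/4 < (2-α)ν; also 2λ = 2ν + α - 1 ≥ ν once ν ≥ 1 - α. -/
theorem exists_lam_sq_lt {α : ℝ} (hα : α < 2) :
    ∃ N : ℝ, 1 / 2 ≤ N ∧ ∀ ν, N ≤ ν → 0 < lam α ν ∧ lam α ν ^ 2 < ν * (ν + 1) := by
  have h2 : 0 < 2 - α := by linarith
  refine ⟨max (max (1 / 2) (1 - α)) ((α - 1) ^ 2 / (2 - α)),
    (le_max_left _ _).trans (le_max_left _ _), fun ν hν => ?_⟩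
  have ha : 1 / 2 ≤ ν := ((le_max_left _ _).trans (le_max_left _ _)).trans hν
  have hb : 1 - α ≤ ν := ((le_max_right _ _).trans (le_max_left _ _)).trans hν
  have hc : (α - 1) ^ 2 / (2 - α) ≤ ν := (le_max_right _ _).trans hν
  rw [div_le_iff₀ h2] at hc
  rw [lam]
  constructor
  · linarith
  · nlinarith [mul_pos (show 0 < ν by linarith) h2]

theorem theorem5 :
    -- the upper bound
    (∀ ν x : ℝ, 1 / 2 ≤ ν → 0 < x → besselI ν x / besselI (ν - 1) x < boundB 0 ν x) ∧
    -- the lower bound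
    (∀ ν x : ℝ, 0 ≤ ν → 0 < x → boundB 2 ν x < besselI ν x / besselI (ν - 1) x) ∧
    -- `B₀` is the best (smallest) upper bound of the form `B_α` with `α` fixed
    (∀ α : ℝ,
      (∀ ν x : ℝ, 1 / 2 ≤ ν → 0 < x → besselI ν x / besselI (ν - 1) x ≤ boundB α ν x) →
      ∀ ν x : ℝ, 1 / 2 ≤ ν → 0 < x → boundB 0 ν x ≤ boundB α ν x) ∧
    -- `B₂` is the best (largest) lower bound of the form `B_α` with `α` fixed
    (∀ α : ℝ,
      (∀ ν x : ℝ, 0 ≤ ν → 0 < x → boundB α ν x ≤ besselI ν x / besselI (ν - 1) x) →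
      ∀ ν x : ℝ, 0 ≤ ν → 0 < x → boundB α ν x ≤ boundB 2 ν x) ∧
    -- `B_α` is strictly decreasing in `α`
    (∀ ν x : ℝ, 0 < x → StrictAnti (fun α : ℝ => boundB α ν x)) ∧
    -- for `α ∈ (0, 2)` and `ν` sufficiently large, `B_α(ν, ·)` is neither an upper
    -- nor a lower bound on the whole of `(0, ∞)`
    (∀ α : ℝ, 0 < α → α < 2 → ∃ N : ℝ, ∀ ν : ℝ, N ≤ ν →
      (¬ ∀ x : ℝ, 0 < x → besselI ν x / besselI (ν - 1) x ≤ boundB α ν x) ∧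
      (¬ ∀ x : ℝ, 0 < x → boundB α ν x ≤ besselI ν x / besselI (ν - 1) x)) := by
  refine ⟨fun ν x hν hx => besselRatio_lt_boundB hν hx, fun ν x hν hx => boundB_lt_besselRatio hν hx,
    fun α h ν x _ hx => (strictAnti_boundB ν hx).antitone ?_,
    fun α h ν x _ hx => (strictAnti_boundB ν hx).antitone ?_,
    fun ν x hx => strictAnti_boundB ν hx, fun α h0 h2 => ?_⟩
  · by_contra! hα
    obtain ⟨y, hy, hlt⟩ := exists_boundB_lt_besselRatio hα le_rfl
    exact absurd (h _ y le_rfl hy) (not_le.2 hlt)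
  · by_contra! hα
    obtain ⟨N, hN, hlam⟩ := exists_lam_sq_lt hα
    obtain ⟨hl, hl2⟩ := hlam N le_rfl
    obtain ⟨y, hy, hlt⟩ := exists_besselRatio_lt_boundB (by linarith) hl hl2
    exact absurd (h N y (by linarith) hy) (not_le.2 hlt)
  · obtain ⟨N, hN, hlam⟩ := exists_lam_sq_lt h2
    refine ⟨N, fun ν hν => ⟨fun h => ?_, fun h => ?_⟩⟩
    · obtain ⟨y, hy, hlt⟩ := exists_boundB_lt_besselRatio h0 (hN.trans hν)
      exact absurd (h y hy) (not_le.2 hlt)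
    · obtain ⟨hl, hl2⟩ := hlam ν hν
      obtain ⟨y, hy, hlt⟩ := exists_besselRatio_lt_boundB (by linarith) hl hl2
      exact absurd (h y hy) (not_le.2 hlt)
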